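/- Let $a,t$ be independent indeterminates and $K=\mathbb Q(a,t)$. Consider the equation $$wxyz(w+x+y+z)=a\qquad(*)$$ and, for nonzero $A,C$, the ansatz $$w=\frac{at}{AC},\quad x=\frac tA,\quad y=\frac{At}{C},\quad z=Ct .$$ 1. (Reduction.) For nonzero $A,C\in K$ the ansatz solves $(*)$ if and only if $$(t^5A-A^2)C^2+t^5C+t^5(a+A^2)=0 .$$ If $A\in K$, $A\ne0$ and $A\neq t^5$, then $C\in K$ satisfies this equation if and only if $C=\dfrac{v-t^5}{2(t^5A-A^2)}$ for some $v\in K$ with $$Q:\quad v^2=4t^5A^4-4t^{10}A^3+4t^5aA^2-4t^{10}aA+t^{10}.$$ 2. (Elliptic curve.) The curve $$E:\ Y^2-4t^5aXY-8t^{15}Y=X^3+(4t^5a-4t^{10}a^2)X^2-16t^{15}X-64t^{20}a+64t^{25}a^2$$ is an elliptic curve over $K$, and $Q$ is birational to $E$ over $K$ via $$X=\frac{2t^5(v+t^5)-4t^{10}aA}{A^2},\qquad Y=\frac{4t^{10}(v+t^5)-8t^{15}aA+8t^{10}aA^2-8t^{15}a^2A^2}{A^3},$$ $$A=\frac{2t^5(X+4t^5a-4t^{10}a^2)}{Y},\qquad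 v=-t^5+\frac{A(AX+4t^{10}a)}{2t^5}$$ (over every extension field of $K$, these maps are mutually inverse bijections between the points of $Q$ with $A\neq 0$ and image $Y\ne0$ and the affine points of $E$ with $X\ne-4t^5a+4t^{10}a^2$ and $Y\ne0$; in both cases only finitely many affine points are left out). 3. (The point $P$.) The point $P=(-4t^5a+4t^{10}a^2,\ -16t^{10}a^2+16t^{15}a^3+8t^{15})$ lies on $E$ and has infinite order in $E(K)$. The point $2P$ has $$X(2P)=\frac{4\big((-a^2-2a^5+a^8)t^{20}+(-2a^4-a-4a^7)t^{15}+(1+6a^6+6a^3)t^{10}+(-2a^2-4a^5)t^5+a^4\big)}{((2a^3+1)t^5-2a^2)^2},$$ and under the birational map and the formula for $C$ in part 1 it gives $$A=\frac{-t^5(-2a^2+2t^5a^3+t^5)}{t^{10}a^4-2t^5a^3-t^5+a^2},\qquad C=\frac{t^{10}+a-2t^5a^2+t^{10}a^3}{t^{10}a^2-1},$$ and hence the solution of $(*)$ $$w=\frac{-a(t^{10}a^4-2t^5a^3-t^5+a^2)(t^5a+1)(t^5a-1)}{t^4(-2a^2+2t^5a^3+t^5)(t^{10}+a-2t^5a^2+t^{10}a^3)},\qquad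 x=\frac{-(t^{10}a^4-2t^5a^3-t^5+a^2)}{t^4(-2a^2+2t^5a^3+t^5)},$$ $$y=\frac{-t^6(-2a^2+2t^5a^3+t^5)(t^5a+1)(t^5a-1)}{(t^{10}a^4-2t^5a^3-t^5+a^2)(t^{10}+a-2t^5a^2+t^{10}a^3)},\qquad z=\frac{(t^{10}+a-2t^5a^2+t^{10}a^3)t}{(t^5a+1)(t^5a-1)} .$$ 4. (Infinitely many parametric solutions.) To a multiple $nP$ ($n\ge1$) that is an affine point with $Y\neq 0$ attach $(A,v)$ by the map of part 2, then $C=\frac{v-t^5}{2(t^5A-A^2)}$, and then $(w,x,y,z)$ by the ansatz, whenever $A\ne0$, $A\neq t^5$ and $C\neq0$. All quadruples in $K^4$ so obtained are solutions of $(*)$, and there are infinitely many of them. Moreover, for every fixed nonzero rational number $a$ the same holds over $\mathbb Q(t)$: with this value of $a$, the point $P$ is a point of infinite order on the curve $E$ over $\mathbb Q(t)$, all quadruples attached to its multiples are solutions of $(*)$ in $\mathbb Q(t)$, and there are infinitely many of them. -/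

import Mathlib

open scoped Classical

namespace WXYZ

variable {K : Type*} [Field K]

/-- `(w, x, y, z)` solves `wxyz(w + x + y + z) = a`. -/
def IsSolution (a : K) (p : K × K × K × K) : Prop :=
  p.1 * p.2.1 * p.2.2.1 * p.2.2.2 * (p.1 + p.2.1 + p.2.2.1 + p.2.2.2) = a

/-- The ansatz `w = at/(AC)`, `x = t/A`, `y = At/C`, `z = Ct`. -/
def ansatz (a t A C : K) : K × K × K × K :=
  (a * t / (A * C), t / A, A * t / C, C * t)

/-- The condition on `A`, `C` obtained from the ansatz, a quadratic equation in `C`. -/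
def Quadratic (a t A C : K) : Prop :=
  (t ^ 5 * A - A ^ 2) * C ^ 2 + t ^ 5 * C + t ^ 5 * (a + A ^ 2) = 0

/-- The right-hand side of the quartic `v² = 4t⁵A⁴ - 4t¹⁰A³ + 4t⁵aA² - 4t¹⁰aA + t¹⁰`,
the discriminant of the quadratic equation in `C`. -/
def quartic (a t A : K) : K :=
  4 * t ^ 5 * A ^ 4 - 4 * t ^ 10 * A ^ 3 + 4 * t ^ 5 * a * A ^ 2 - 4 * t ^ 10 * a * A + t ^ 10

/-- The affine plane curve `v² = quartic(A)`, as the set of its points `(A, v)` over `K`. -/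
def quarticPoints (a t : K) : Set (K × K) :=
  {p | p.2 ^ 2 = quartic a t p.1}

/-- The root `C` of the quadratic equation that belongs to the square root `v` of its
discriminant. -/
def rootC (t A v : K) : K :=
  (v - t ^ 5) / (2 * (t ^ 5 * A - A ^ 2))

/-- The curve
`Y² - 4t⁵aXY - 8t¹⁵Y = X³ + (4t⁵a - 4t¹⁰a²)X² - 16t¹⁵X - 64t²⁰a + 64t²⁵a²`. -/
def curve (a t : K) : WeierstrassCurve.Affine K where
  a₁ := -4 * t ^ 5 * a
  a₂ := 4 * t ^ 5 * a - 4 * t ^ 10 * a ^ 2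
  a₃ := -8 * t ^ 15
  a₄ := -16 * t ^ 15
  a₆ := -64 * t ^ 20 * a + 64 * t ^ 25 * a ^ 2

/-- The affine points `(X, Y)` of the curve over `K`. -/
def curvePoints (a t : K) : Set (K × K) :=
  {p | (curve a t).Equation p.1 p.2}

/-- The `X`-coordinate of the point `P`. -/
def pX (a t : K) : K := -4 * t ^ 5 * a + 4 * t ^ 10 * a ^ 2

/-- The `Y`-coordinate of the point `P`. -/
def pY (a t : K) : K := -16 * t ^ 10 * a ^ 2 + 16 * t ^ 15 * a ^ 3 + 8 * t ^ 15

/-- The rational map `(A, v) ↦ (X, Y)` from the quartic to the Weierstrass curve. -/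
def toCurve (a t : K) (p : K × K) : K × K :=
  ((2 * t ^ 5 * (p.2 + t ^ 5) - 4 * t ^ 10 * a * p.1) / p.1 ^ 2,
   (4 * t ^ 10 * (p.2 + t ^ 5) - 8 * t ^ 15 * a * p.1 + 8 * t ^ 10 * a * p.1 ^ 2
      - 8 * t ^ 15 * a ^ 2 * p.1 ^ 2) / p.1 ^ 3)

/-- The `A`-coordinate of the rational map from the Weierstrass curve to the quartic. -/
def coordA (a t X Y : K) : K :=
  2 * t ^ 5 * (X + (4 * t ^ 5 * a - 4 * t ^ 10 * a ^ 2)) / Y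

/-- The `v`-coordinate of the rational map from the Weierstrass curve to the quartic. -/
def coordV (a t X Y : K) : K :=
  -t ^ 5 + coordA a t X Y * (coordA a t X Y * X + 4 * t ^ 10 * a) / (2 * t ^ 5)

/-- The rational map `(X, Y) ↦ (A, v)` from the Weierstrass curve to the quartic. -/
def toQuartic (a t : K) (p : K × K) : K × K :=
  (coordA a t p.1 p.2, coordV a t p.1 p.2)

/-- `toCurve` and `toQuartic` are mutually inverse bijections between the complements of finite
sets in the `K`-points of the quartic and of the Weierstrass curve. These complements are cut out
by the nonvanishing of denominators and coordinates. -/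
def InverseOffFinite (a t : K) : Prop :=
  let U : Set (K × K) := {p ∈ quarticPoints a t | p.1 ≠ 0 ∧ (toCurve a t p).2 ≠ 0}
  let V : Set (K × K) := {p ∈ curvePoints a t | p.1 ≠ pX a t ∧ p.2 ≠ 0}
  Set.BijOn (toCurve a t) U V ∧ Set.InvOn (toQuartic a t) (toCurve a t) U V ∧
    (quarticPoints a t \ U).Finite ∧ (curvePoints a t \ V).Finite

/-- The explicit rational maps give a birational equivalence between the quartic and the
Weierstrass curve over `K`: over every extension field of `K` they are mutually inverse off finite
sets of points. -/
def IsBirational {K : Type} [Field K] (a t : K) : Prop :=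
  ∀ (L : Type) [Field L] [Algebra K L], InverseOffFinite (algebraMap K L a) (algebraMap K L t)

/-- The quadruples `(w, x, y, z)` that come from the positive multiples `nP` of a point `P` of the
Weierstrass curve: the image `(A, v)` of `nP` on the quartic gives `C`, and `A`, `C` give
`(w, x, y, z)`. Multiples at which a denominator vanishes on the way give no quadruple. -/
noncomputable def family (a t : K) (P : (curve a t).Point) : Set (K × K × K × K) :=
  {p | ∃ n : ℕ, 0 < n ∧ ∃ (X Y : K) (h : (curve a t).Nonsingular X Y),
    n • P = WeierstrassCurve.Affine.Point.some X Y h ∧ Y ≠ 0 ∧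
    ∃ A C : K, A = coordA a t X Y ∧ C = rootC t A (coordV a t X Y) ∧
      A ≠ 0 ∧ A ≠ t ^ 5 ∧ C ≠ 0 ∧ p = ansatz a t A C}

/-- The `X`-coordinate of `2P`. -/
def twoPX (a t : K) : K :=
  4 * ((-a ^ 2 - 2 * a ^ 5 + a ^ 8) * t ^ 20 + (-2 * a ^ 4 - a - 4 * a ^ 7) * t ^ 15
      + (1 + 6 * a ^ 6 + 6 * a ^ 3) * t ^ 10 + (-2 * a ^ 2 - 4 * a ^ 5) * t ^ 5 + a ^ 4)
    / ((2 * a ^ 3 + 1) * t ^ 5 - 2 * a ^ 2) ^ 2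

/-- The value of `A` that belongs to `2P`. -/
def twoPA (a t : K) : K :=
  -t ^ 5 * (-2 * a ^ 2 + 2 * t ^ 5 * a ^ 3 + t ^ 5)
    / (t ^ 10 * a ^ 4 - 2 * t ^ 5 * a ^ 3 - t ^ 5 + a ^ 2)

/-- The value of `C` that belongs to `2P`. -/
def twoPC (a t : K) : K :=
  (t ^ 10 + a - 2 * t ^ 5 * a ^ 2 + t ^ 10 * a ^ 3) / (t ^ 10 * a ^ 2 - 1)

/-- The explicit quadruple `(w, x, y, z)` that belongs to `2P`. -/
def twoPSolution (a t : K) : K × K × K × K :=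
  (-a * (t ^ 10 * a ^ 4 - 2 * t ^ 5 * a ^ 3 - t ^ 5 + a ^ 2) * (t ^ 5 * a + 1) * (t ^ 5 * a - 1)
      / (t ^ 4 * (-2 * a ^ 2 + 2 * t ^ 5 * a ^ 3 + t ^ 5)
          * (t ^ 10 + a - 2 * t ^ 5 * a ^ 2 + t ^ 10 * a ^ 3)),
   -(t ^ 10 * a ^ 4 - 2 * t ^ 5 * a ^ 3 - t ^ 5 + a ^ 2)
      / (t ^ 4 * (-2 * a ^ 2 + 2 * t ^ 5 * a ^ 3 + t ^ 5)),
   -t ^ 6 * (-2 * a ^ 2 + 2 * t ^ 5 * a ^ 3 + t ^ 5) * (t ^ 5 * a + 1) * (t ^ 5 * a - 1)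
      / ((t ^ 10 * a ^ 4 - 2 * t ^ 5 * a ^ 3 - t ^ 5 + a ^ 2)
          * (t ^ 10 + a - 2 * t ^ 5 * a ^ 2 + t ^ 10 * a ^ 3)),
   (t ^ 10 + a - 2 * t ^ 5 * a ^ 2 + t ^ 10 * a ^ 3) * t / ((t ^ 5 * a + 1) * (t ^ 5 * a - 1)))

/-- The field `ℚ(a, t) = ℚ(a)(t)`. -/
abbrev Qat : Type := RatFunc (RatFunc ℚ)

/-- The indeterminate `a` of `ℚ(a, t)`. -/
noncomputable def aGen : Qat := RatFunc.C RatFunc.X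

/-- The indeterminate `t` of `ℚ(a, t)`. -/
noncomputable def tGen : Qat := RatFunc.X

end WXYZ

/-! The reduction of the ansatz is completion of the square. For the birational map, eliminating `v`
from the quartic and `Y` from the cubic leaves one and the same relation `LinkAX` between `A` and
`X`, so each curve equation is equivalent to it wherever the denominators do not vanish. The
infinite order of `P` comes from specialising `t = 0`. There the curve degenerates to the cuspidal
cubic `Y² = X³`, whose nonsingular points `(u², u³)` add through the parameter `X/Y = 1/u`. The
point `P` falls into the cusp, but `2P` specialises to `(1, 1)`, so doubling (`two_nsmul_reducesTo`)
gives `2^(n+1) P` the parameter `2^n`, and in characteristic zero these are distinct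
(`two_pow_nsmul_P`). The same specialisation shows that `A / t^5` takes the value `2^(n+1)`, which
makes the attached solutions distinct (`family_infinite`). All this works over `k(t)` for any field
`k` of characteristic zero and any nonzero `α` in `k` in the role of `a`; `k = ℚ(a)` and `k = ℚ`
give the two halves of the theorem. -/

namespace WXYZ

/-! ### The ansatz, the quadratic in `C`, and the maps between quartic and cubic. -/

section Maps

variable {K : Type*} [Field K] {a t : K}

theorem isSolution_ansatz_iff (ha : a ≠ 0) {A C : K} (hA : A ≠ 0) (hC : C ≠ 0) :
    IsSolution a (ansatz a t A C) ↔ Quadratic a t A C := by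
  have key : a * t / (A * C) * (t / A) * (A * t / C) * (C * t) *
      (a * t / (A * C) + t / A + A * t / C + C * t) - a =
      a / (A ^ 2 * C ^ 2) * ((t ^ 5 * A - A ^ 2) * C ^ 2 + t ^ 5 * C + t ^ 5 * (a + A ^ 2)) := by
    field_simp
    ring
  have h0 : a / (A ^ 2 * C ^ 2) ≠ 0 :=
    div_ne_zero ha (mul_ne_zero (pow_ne_zero 2 hA) (pow_ne_zero 2 hC))
  simp only [IsSolution, ansatz, Quadratic]
  rw [← sub_eq_zero, key, mul_eq_zero]
  simp [h0]

theorem quadratic_iff (h2 : (2 : K) ≠ 0) {A C : K} (hA : A ≠ 0) (hAt : A ≠ t ^ 5) :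
    Quadratic a t A C ↔ ∃ v : K, (A, v) ∈ quarticPoints a t ∧ C = rootC t A v := by
  have hd : t ^ 5 * A - A ^ 2 ≠ 0 := by
    rw [show t ^ 5 * A - A ^ 2 = A * (t ^ 5 - A) by ring]
    exact mul_ne_zero hA (sub_ne_zero.2 hAt.symm)
  have h4 : (4 : K) ≠ 0 := by
    rw [show (4 : K) = 2 * 2 by norm_num]
    exact mul_ne_zero h2 h2
  simp only [Quadratic, quarticPoints, quartic, rootC, Set.mem_ofPred_eq]
  constructor
  · intro h
    -- The derivative of the quadratic at `C`: its square is the discriminant when `C` is a root.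
    refine ⟨2 * (t ^ 5 * A - A ^ 2) * C + t ^ 5, ?_, ?_⟩
    · linear_combination 4 * (t ^ 5 * A - A ^ 2) * h
    · rw [eq_div_iff (mul_ne_zero h2 hd)]
      ring
  · rintro ⟨v, hv, hC⟩
    rw [eq_div_iff (mul_ne_zero h2 hd)] at hC
    obtain rfl : v = 2 * (t ^ 5 * A - A ^ 2) * C + t ^ 5 := by linear_combination -hC
    refine (mul_eq_zero.1 ?_).resolve_left (mul_ne_zero h4 hd)
    linear_combination hv

/-- The cubic in `X` factors because `a₆ = a₂ * a₄`, with `-a₂ = pX` as a root. This is why `X - pX`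
governs the whole correspondence. -/
theorem mem_curvePoints_iff {X Y : K} : (X, Y) ∈ curvePoints a t ↔
    (X - pX a t) * (X ^ 2 - 16 * t ^ 15) + Y * (4 * t ^ 5 * a * X + 8 * t ^ 15) - Y ^ 2 = 0 := by
  simp only [curvePoints, Set.mem_ofPred_eq, WeierstrassCurve.Affine.equation_iff', curve, pX]
  constructor <;> intro h <;> linear_combination -h

/-- The polynomial relation between `A` and `X` that describes both curves. -/
def LinkAX (a t A X : K) : Prop :=
  A ^ 2 * (X ^ 2 - 16 * t ^ 15) + A * (8 * t ^ 10 * a * X + 16 * t ^ 20)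
    - 4 * t ^ 10 * (X - pX a t) = 0

/-- `(A, v)` and `(X, Y)` correspond to each other. -/
def Corresponds (a t A v X Y : K) : Prop :=
  2 * t ^ 5 * (v + t ^ 5) = A * (A * X + 4 * t ^ 10 * a) ∧ A * Y = 2 * t ^ 5 * (X - pX a t)

theorem toCurve_eq_iff {A v X Y : K} (hA : A ≠ 0) :
    toCurve a t (A, v) = (X, Y) ↔ Corresponds a t A v X Y := by
  simp only [toCurve, Prod.mk.injEq, Corresponds, pX]
  rw [div_eq_iff (pow_ne_zero 2 hA), div_eq_iff (pow_ne_zero 3 hA)]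
  constructor
  · rintro ⟨h1, h2⟩
    refine ⟨by linear_combination h1, mul_left_cancel₀ (pow_ne_zero 2 hA) ?_⟩
    linear_combination -h2 + 2 * t ^ 5 * h1
  · rintro ⟨h1, h2⟩
    exact ⟨by linear_combination h1, by linear_combination -A ^ 2 * h2 + 2 * t ^ 5 * h1⟩

theorem toQuartic_eq_iff (h2 : (2 : K) ≠ 0) (ht : t ≠ 0) {A v X Y : K} (hY : Y ≠ 0) :
    toQuartic a t (X, Y) = (A, v) ↔ Corresponds a t A v X Y := by
  have hs : 2 * t ^ 5 ≠ 0 := mul_ne_zero h2 (pow_ne_zero 5 ht)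
  simp only [toQuartic, Prod.mk.injEq, Corresponds]
  have hA : coordA a t X Y = A ↔ A * Y = 2 * t ^ 5 * (X - pX a t) := by
    rw [coordA, div_eq_iff hY, pX, eq_comm]
    ring_nf
  rw [and_comm, ← hA]
  refine and_congr_left fun h ↦ ?_
  rw [coordV, h, eq_comm, ← sub_eq_iff_eq_add', eq_div_iff hs, sub_neg_eq_add]
  ring_nf

/-- Only the first relation of `Corresponds` enters: it eliminates `v`, and a factor `A ^ 2` splits
off. -/
theorem Corresponds.mem_quarticPoints_iff (h2 : (2 : K) ≠ 0) (ht : t ≠ 0) {A v X Y : K}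
    (hA : A ≠ 0) (h : Corresponds a t A v X Y) :
    (A, v) ∈ quarticPoints a t ↔ LinkAX a t A X := by
  have h4 : 4 * t ^ 10 ≠ 0 := by
    rw [show 4 * t ^ 10 = (2 * t ^ 5) ^ 2 by ring]
    exact pow_ne_zero 2 (mul_ne_zero h2 (pow_ne_zero 5 ht))
  have key : 4 * t ^ 10 * (v ^ 2 - quartic a t A) = A ^ 2 *
      (A ^ 2 * (X ^ 2 - 16 * t ^ 15) + A * (8 * t ^ 10 * a * X + 16 * t ^ 20)
        - 4 * t ^ 10 * (X - pX a t)) := by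
    simp only [quartic, pX]
    linear_combination (2 * t ^ 5 * (v - t ^ 5) + A * (A * X + 4 * t ^ 10 * a)) * h.1
  simp only [quarticPoints, Set.mem_ofPred_eq, LinkAX]
  rw [← sub_eq_zero, ← mul_eq_zero_iff_left h4, key,
    mul_eq_zero_iff_left (pow_ne_zero 2 hA)]

/-- Only the second relation enters: it eliminates `Y`, and the factor `X - pX` splits off. -/
theorem Corresponds.mem_curvePoints_iff {A v X Y : K}
    (hA : A ≠ 0) (hX : X ≠ pX a t) (h : Corresponds a t A v X Y) :
    (X, Y) ∈ curvePoints a t ↔ LinkAX a t A X := by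
  have key : A ^ 2 * ((X - pX a t) * (X ^ 2 - 16 * t ^ 15)
      + Y * (4 * t ^ 5 * a * X + 8 * t ^ 15) - Y ^ 2) = (X - pX a t) *
      (A ^ 2 * (X ^ 2 - 16 * t ^ 15) + A * (8 * t ^ 10 * a * X + 16 * t ^ 20)
        - 4 * t ^ 10 * (X - pX a t)) := by
    linear_combination (A * (4 * t ^ 5 * a * X + 8 * t ^ 15)
      - (A * Y + 2 * t ^ 5 * (X - pX a t))) * h.2
  rw [WXYZ.mem_curvePoints_iff, LinkAX,
    ← mul_eq_zero_iff_left (pow_ne_zero 2 hA), key,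
    mul_eq_zero_iff_left (sub_ne_zero.2 hX)]

theorem Corresponds.ne_zero_iff (h2 : (2 : K) ≠ 0) (ht : t ≠ 0) {A v X Y : K}
    (h : Corresponds a t A v X Y) : A ≠ 0 ∧ Y ≠ 0 ↔ X ≠ pX a t := by
  rw [← sub_ne_zero (a := X), ← mul_ne_zero_iff, h.2,
    mul_ne_zero_iff_left (mul_ne_zero h2 (pow_ne_zero 5 ht))]

theorem finite_sq_eq (c : K) : {x : K | x ^ 2 = c}.Finite := by
  have hp : (Polynomial.X ^ 2 - Polynomial.C c : Polynomial K) ≠ 0 :=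
    Polynomial.X_pow_sub_C_ne_zero two_pos c
  refine (Polynomial.finite_setOfPred_isRoot hp).subset fun x hx ↦ ?_
  simpa [Polynomial.IsRoot, sub_eq_zero] using hx

theorem finite_quarticPoints_diff (h2 : (2 : K) ≠ 0) (ht : t ≠ 0)
    (hD : (2 * a ^ 3 + 1) * t ^ 5 - 2 * a ^ 2 ≠ 0) :
    (quarticPoints a t \ {p ∈ quarticPoints a t | p.1 ≠ 0 ∧ (toCurve a t p).2 ≠ 0}).Finite := by
  have hs : t ^ 5 ≠ 0 := pow_ne_zero 5 ht
  have h4 : (4 : K) ≠ 0 := by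
    rw [show (4 : K) = 2 * 2 by norm_num]
    exact mul_ne_zero h2 h2
  set D := (2 * a ^ 3 + 1) * t ^ 5 - 2 * a ^ 2 with hDdef
  set e := -2 * a + 2 * t ^ 5 * a ^ 2 with he
  set A₁ := -(4 * t ^ 5 * D) / (e ^ 2 - 4 * t ^ 5) with hA₁
  have hfin : ({0, A₁} ×ˢ ({v | v ^ 2 = quartic a t 0} ∪ {v | v ^ 2 = quartic a t A₁}) :
      Set (K × K)).Finite :=
    (Set.toFinite _).prod ((finite_sq_eq _).union (finite_sq_eq _))
  refine hfin.subset ?_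
  rintro ⟨A, v⟩ ⟨hq, hn⟩
  have hv : v ^ 2 = quartic a t A := hq
  rcases eq_or_ne A 0 with rfl | hA
  · exact ⟨by simp, Or.inl hv⟩
  · have hY : (toCurve a t (A, v)).2 = 0 := by
      by_contra hY
      exact hn ⟨hq, hA, hY⟩
    obtain ⟨h1, h3⟩ := (toCurve_eq_iff hA (X := (toCurve a t (A, v)).1) (Y := 0)).1
      (Prod.ext rfl hY)
    have hX : (toCurve a t (A, v)).1 = pX a t := by
      rw [mul_zero, eq_comm, mul_eq_zero_iff_left (mul_ne_zero h2 hs), sub_eq_zero] at h3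
      exact h3
    rw [hX, pX] at h1
    -- The excluded points with `Y = 0` lie on a parabola that meets the quartic to third order at
    -- `A = 0`, so one linear equation for `A` remains.
    have hv' : v = -t ^ 5 + 2 * t ^ 5 * a * A + e * A ^ 2 := by
      refine mul_left_cancel₀ (mul_ne_zero h2 hs) ?_
      linear_combination h1
    have hlin : A * (e ^ 2 - 4 * t ^ 5) = -(4 * t ^ 5 * D) := by
      refine mul_left_cancel₀ (pow_ne_zero 3 hA) ?_
      rw [hv', quartic, he] at hv
      rw [hDdef, he]
      linear_combination hv
    -- If this coefficient vanished, `A₁` would be `0` by the convention for division, but the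
    -- linear equation would then force `D = 0`.
    have hne : e ^ 2 - 4 * t ^ 5 ≠ 0 := by
      intro h0
      rw [h0, mul_zero, eq_comm, neg_eq_zero] at hlin
      exact mul_ne_zero (mul_ne_zero h4 hs) hD hlin
    have hA' : A = A₁ := by rw [hA₁, eq_div_iff hne, hlin]
    exact ⟨by simp [hA'], Or.inr (by rw [← hA']; exact hv)⟩

theorem finite_curvePoints_diff :
    (curvePoints a t \ {p ∈ curvePoints a t | p.1 ≠ pX a t ∧ p.2 ≠ 0}).Finite := by
  have hY : {Y : K | Y = 0 ∨ Y = 4 * t ^ 5 * a * pX a t + 8 * t ^ 15}.Finite :=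
    Set.toFinite {0, 4 * t ^ 5 * a * pX a t + 8 * t ^ 15}
  have hX : {X : K | X = pX a t ∨ X ^ 2 = 16 * t ^ 15}.Finite :=
    (Set.finite_singleton (pX a t)).union (finite_sq_eq _)
  refine (hX.prod hY).subset ?_
  rintro ⟨X, Y⟩ ⟨hc, hn⟩
  have h := mem_curvePoints_iff.1 hc
  by_cases hX0 : X = pX a t
  · refine ⟨Or.inl hX0, ?_⟩
    have : Y * (4 * t ^ 5 * a * pX a t + 8 * t ^ 15 - Y) = 0 := by
      rw [hX0] at h
      linear_combination h
    rcases mul_eq_zero.1 this with h0 | h0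
    · exact Or.inl h0
    · exact Or.inr (sub_eq_zero.1 h0).symm
  · have hY0 : Y = 0 := by
      by_contra hY0
      exact hn ⟨hc, hX0, hY0⟩
    refine ⟨Or.inr ?_, Or.inl hY0⟩
    rw [hY0] at h
    refine sub_eq_zero.1 (mul_left_cancel₀ (sub_ne_zero.2 hX0) ?_)
    linear_combination h

theorem inverseOffFinite (h2 : (2 : K) ≠ 0) (ht : t ≠ 0)
    (hD : (2 * a ^ 3 + 1) * t ^ 5 - 2 * a ^ 2 ≠ 0) : InverseOffFinite a t := by
  unfold InverseOffFinite
  intro U V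
  have hU : ∀ p ∈ U, toCurve a t p ∈ V ∧ toQuartic a t (toCurve a t p) = p := by
    rintro ⟨A, v⟩ ⟨hq, hA, hY⟩
    have hc := (toCurve_eq_iff hA).1 (Prod.mk.eta (p := toCurve a t (A, v))).symm
    have hX := (hc.ne_zero_iff h2 ht).1 ⟨hA, hY⟩
    exact ⟨⟨(hc.mem_curvePoints_iff hA hX).2 ((hc.mem_quarticPoints_iff h2 ht hA).1 hq), hX, hY⟩,
      (toQuartic_eq_iff h2 ht hY).2 hc⟩
  have hV : ∀ p ∈ V, toQuartic a t p ∈ U ∧ toCurve a t (toQuartic a t p) = p := by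
    rintro ⟨X, Y⟩ ⟨hq, hX, hY⟩
    have hc := (toQuartic_eq_iff h2 ht hY).1 (Prod.mk.eta (p := toQuartic a t (X, Y))).symm
    have hA := ((hc.ne_zero_iff h2 ht).2 hX).1
    have heq := (toCurve_eq_iff hA).2 hc
    refine ⟨⟨(hc.mem_quarticPoints_iff h2 ht hA).2 ((hc.mem_curvePoints_iff hA hX).1 hq), hA, ?_⟩,
      heq⟩
    rw [Prod.mk.eta] at heq
    rw [heq]
    exact hY
  have hinv : Set.InvOn (toQuartic a t) (toCurve a t) U V :=
    ⟨fun p hp ↦ (hU p hp).2, fun p hp ↦ (hV p hp).2⟩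
  exact ⟨hinv.bijOn (fun p hp ↦ (hU p hp).1) fun p hp ↦ (hV p hp).1, hinv,
    finite_quarticPoints_diff h2 ht hD, finite_curvePoints_diff⟩

theorem quadratic_rootC (h2 : (2 : K) ≠ 0) (ht : t ≠ 0) {X Y : K}
    (h : (X, Y) ∈ curvePoints a t) (hY : Y ≠ 0) (hA0 : coordA a t X Y ≠ 0)
    (hAt : coordA a t X Y ≠ t ^ 5) :
    Quadratic a t (coordA a t X Y) (rootC t (coordA a t X Y) (coordV a t X Y)) := by
  rw [quadratic_iff h2 hA0 hAt]
  have hc : Corresponds a t (coordA a t X Y) (coordV a t X Y) X Y :=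
    (toQuartic_eq_iff h2 ht hY).1 rfl
  refine ⟨_, (hc.mem_quarticPoints_iff h2 ht hA0).2 ?_, rfl⟩
  exact (hc.mem_curvePoints_iff hA0 ((hc.ne_zero_iff h2 ht).1 ⟨hA0, hY⟩)).1 h

theorem isSolution_of_mem_family (h2 : (2 : K) ≠ 0) (ha : a ≠ 0) (ht : t ≠ 0)
    {P : (curve a t).Point} {p : K × K × K × K} (hp : p ∈ family a t P) : IsSolution a p := by
  obtain ⟨n, -, X, Y, h, -, hY, A, C, rfl, rfl, hA0, hAt, hC0, rfl⟩ := hp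
  rw [isSolution_ansatz_iff ha hA0 hC0]
  exact quadratic_rootC h2 ht h.1 hY hA0 hAt

end Maps

end WXYZ

namespace WXYZ

/-! ### Doubling on the cubic, and the point `2P`. -/

section Doubling

variable {K : Type*} [Field K] {a t : K}

theorem two_nsmul_some {X Y X' Y' l : K} (h : (curve a t).Nonsingular X Y)
    (hY : 2 * Y - 4 * t ^ 5 * a * X - 8 * t ^ 15 ≠ 0)
    (hl : l = (3 * X ^ 2 + 2 * (4 * t ^ 5 * a - 4 * t ^ 10 * a ^ 2) * X - 16 * t ^ 15
      + 4 * t ^ 5 * a * Y) / (2 * Y - 4 * t ^ 5 * a * X - 8 * t ^ 15))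
    (hX' : X' = l ^ 2 - 4 * t ^ 5 * a * l - (4 * t ^ 5 * a - 4 * t ^ 10 * a ^ 2) - 2 * X)
    (hY' : Y' = -(l * (X' - X) + Y) + 4 * t ^ 5 * a * X' + 8 * t ^ 15) :
    ∃ h' : (curve a t).Nonsingular X' Y',
      2 • WeierstrassCurve.Affine.Point.some X Y h =
        WeierstrassCurve.Affine.Point.some X' Y' h' := by
  have hsub : Y - (curve a t).negY X Y = 2 * Y - 4 * t ^ 5 * a * X - 8 * t ^ 15 := by
    simp only [WeierstrassCurve.Affine.negY, curve]
    ring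
  have hne : Y ≠ (curve a t).negY X Y := by rwa [← sub_ne_zero, hsub]
  have hslope : (curve a t).slope X X Y Y = l := by
    rw [WeierstrassCurve.Affine.slope_of_Y_ne rfl hne, hsub, hl]
    simp only [curve]
    ring
  have haddX : (curve a t).addX X X ((curve a t).slope X X Y Y) = X' := by
    rw [hslope, hX', WeierstrassCurve.Affine.addX]
    simp only [curve]
    ring
  have haddY : (curve a t).addY X X Y ((curve a t).slope X X Y Y) = Y' := by
    rw [WeierstrassCurve.Affine.addY, WeierstrassCurve.Affine.negAddY, haddX, hslope, hY',
      WeierstrassCurve.Affine.negY]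
    simp only [curve]
    ring
  have hns := WeierstrassCurve.Affine.nonsingular_add h h fun hxy ↦ hne hxy.2
  refine ⟨haddX ▸ haddY ▸ hns, ?_⟩
  rw [two_nsmul, WeierstrassCurve.Affine.Point.add_self_of_Y_ne hne,
    WeierstrassCurve.Affine.Point.some.injEq]
  exact ⟨haddX, haddY⟩

/-- The `Y`-coordinate of `2P`. -/
def twoPY (a t : K) : K :=
  -2 * (twoPX a t - pX a t) * (t ^ 10 * a ^ 4 - 2 * t ^ 5 * a ^ 3 - t ^ 5 + a ^ 2)
    / ((2 * a ^ 3 + 1) * t ^ 5 - 2 * a ^ 2)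

/-- The partial derivative in `Y` at `P` is `8 t^10` times the denominator in `hD`; its nonvanishing
also says that `P` is not its own negative. -/
theorem nonsingular_P (h2 : (2 : K) ≠ 0) (ht : t ≠ 0)
    (hD : (2 * a ^ 3 + 1) * t ^ 5 - 2 * a ^ 2 ≠ 0) :
    (curve a t).Nonsingular (pX a t) (pY a t) := by
  rw [WeierstrassCurve.Affine.nonsingular_iff']
  refine ⟨mem_curvePoints_iff.2 ?_, Or.inr ?_⟩
  · simp only [pX]
    ring
  · have : 2 * pY a t + (curve a t).a₁ * pX a t + (curve a t).a₃ =
        2 ^ 3 * t ^ 10 * ((2 * a ^ 3 + 1) * t ^ 5 - 2 * a ^ 2) := by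
      simp only [pX, pY, curve]
      ring
    rw [this]
    exact mul_ne_zero (mul_ne_zero (pow_ne_zero 3 h2) (pow_ne_zero 10 ht)) hD

theorem two_nsmul_P (h2 : (2 : K) ≠ 0) (ht : t ≠ 0)
    (hD : (2 * a ^ 3 + 1) * t ^ 5 - 2 * a ^ 2 ≠ 0)
    (hP : (curve a t).Nonsingular (pX a t) (pY a t)) :
    ∃ h : (curve a t).Nonsingular (twoPX a t) (twoPY a t),
      2 • WeierstrassCurve.Affine.Point.some _ _ hP =
        WeierstrassCurve.Affine.Point.some _ _ h := by
  have hden : 2 * pY a t - 4 * t ^ 5 * a * pX a t - 8 * t ^ 15 =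
      8 * t ^ 10 * ((2 * a ^ 3 + 1) * t ^ 5 - 2 * a ^ 2) := by
    simp only [pX, pY]
    ring
  have h8 : (8 : K) * t ^ 10 ≠ 0 := by
    rw [show (8 : K) = 2 ^ 3 by norm_num]
    exact mul_ne_zero (pow_ne_zero 3 h2) (pow_ne_zero 10 ht)
  set D := (2 * a ^ 3 + 1) * t ^ 5 - 2 * a ^ 2 with hDdef
  -- The tangent slope at `P`, with the common factor `8 t^10` cancelled.
  have hl : 2 * (5 * t ^ 10 * a ^ 4 + 2 * t ^ 10 * a - 6 * t ^ 5 * a ^ 3 - t ^ 5 + a ^ 2) / D =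
      (3 * pX a t ^ 2 + 2 * (4 * t ^ 5 * a - 4 * t ^ 10 * a ^ 2) * pX a t - 16 * t ^ 15
      + 4 * t ^ 5 * a * pY a t) / (2 * pY a t - 4 * t ^ 5 * a * pX a t - 8 * t ^ 15) := by
    rw [hden, div_eq_div_iff hD (mul_ne_zero h8 hD)]
    simp only [pX, pY]
    ring
  have hX : twoPX a t = (2 * (5 * t ^ 10 * a ^ 4 + 2 * t ^ 10 * a - 6 * t ^ 5 * a ^ 3 - t ^ 5
      + a ^ 2) / D) ^ 2 - 4 * t ^ 5 * a * (2 * (5 * t ^ 10 * a ^ 4 + 2 * t ^ 10 * a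
      - 6 * t ^ 5 * a ^ 3 - t ^ 5 + a ^ 2) / D) - (4 * t ^ 5 * a - 4 * t ^ 10 * a ^ 2)
      - 2 * pX a t := by
    rw [twoPX, ← hDdef]
    simp only [pX]
    field_simp
    rw [hDdef]
    ring
  refine two_nsmul_some hP (by rw [hden]; exact mul_ne_zero h8 hD) hl hX ?_
  rw [twoPY, twoPX, ← hDdef]
  simp only [pX, pY]
  field_simp
  rw [hDdef]
  ring

end Doubling

/-! ### Values at `0` of rational functions regular there. -/

section Reduction

open Polynomial

variable {k : Type*} [Field k]

/-- The rational function `x` is regular at `0`, with value `c`. -/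
def ReducesTo (x : RatFunc k) (c : k) : Prop :=
  ∃ p q : k[X], q.eval 0 ≠ 0 ∧ x * algebraMap k[X] (RatFunc k) q = algebraMap k[X] (RatFunc k) p ∧
    p.eval 0 = c * q.eval 0

namespace ReducesTo

variable {x y : RatFunc k} {c d : k}

theorem unique (h : ReducesTo x c) (h' : ReducesTo x d) : c = d := by
  obtain ⟨p, q, hq, hx, hp⟩ := h
  obtain ⟨p', q', hq', hx', hp'⟩ := h'
  have : p * q' = p' * q := by
    apply RatFunc.algebraMap_injective k
    rw [map_mul, map_mul, ← hx, ← hx']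
    ring
  have := congrArg (Polynomial.eval 0) this
  rw [eval_mul, eval_mul, hp, hp'] at this
  refine mul_right_cancel₀ (mul_ne_zero hq hq') ?_
  linear_combination this

theorem congr_value (h : ReducesTo x c) (hc : c = d) : ReducesTo x d := hc ▸ h

theorem algebraMap_poly (p : k[X]) : ReducesTo (algebraMap k[X] (RatFunc k) p) (p.eval 0) :=
  ⟨p, 1, by simp, by simp, by simp⟩

theorem const (c : k) : ReducesTo (RatFunc.C c) c := by
  simpa using algebraMap_poly (Polynomial.C c)

theorem X : ReducesTo (RatFunc.X : RatFunc k) 0 := by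
  simpa using algebraMap_poly (Polynomial.X : k[X])

theorem zero : ReducesTo (0 : RatFunc k) 0 := by
  simpa using const (0 : k)

theorem one : ReducesTo (1 : RatFunc k) 1 := by
  simpa using const (1 : k)

theorem ofNat (n : ℕ) [n.AtLeastTwo] :
    ReducesTo (OfNat.ofNat n : RatFunc k) (OfNat.ofNat n) := by
  exact (map_ofNat (RatFunc.C (K := k)) n) ▸ const _

theorem add (h : ReducesTo x c) (h' : ReducesTo y d) : ReducesTo (x + y) (c + d) := by
  obtain ⟨p, q, hq, hx, hp⟩ := h
  obtain ⟨p', q', hq', hx', hp'⟩ := h'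
  refine ⟨p * q' + p' * q, q * q', by simp [hq, hq'], ?_, ?_⟩
  · simp only [map_add, map_mul, ← hx, ← hx']
    ring
  · simp only [eval_add, eval_mul, hp, hp']
    ring

theorem mul (h : ReducesTo x c) (h' : ReducesTo y d) : ReducesTo (x * y) (c * d) := by
  obtain ⟨p, q, hq, hx, hp⟩ := h
  obtain ⟨p', q', hq', hx', hp'⟩ := h'
  refine ⟨p * p', q * q', by simp [hq, hq'], ?_, ?_⟩
  · simp only [map_mul, ← hx, ← hx']
    ring
  · simp only [eval_mul, hp, hp']
    ring

theorem neg (h : ReducesTo x c) : ReducesTo (-x) (-c) := by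
  simpa using (const (-1 : k)).mul h

theorem sub (h : ReducesTo x c) (h' : ReducesTo y d) : ReducesTo (x - y) (c - d) := by
  simpa [sub_eq_add_neg] using h.add h'.neg

theorem pow (h : ReducesTo x c) (n : ℕ) : ReducesTo (x ^ n) (c ^ n) := by
  induction n with
  | zero => simpa using one
  | succ n ih => simpa [pow_succ] using ih.mul h

theorem ne_zero (h : ReducesTo x c) (hc : c ≠ 0) : x ≠ 0 := by
  rintro rfl
  exact hc (h.unique zero)

theorem inv (h : ReducesTo x c) (hc : c ≠ 0) : ReducesTo x⁻¹ c⁻¹ := by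
  have hx0 := h.ne_zero hc
  obtain ⟨p, q, hq, hx, hp⟩ := h
  refine ⟨q, p, by simp [hp, hc, hq], ?_, ?_⟩
  · rw [← hx, inv_mul_cancel_left₀ hx0]
  · rw [hp, inv_mul_cancel_left₀ hc]

theorem div (h : ReducesTo x c) (h' : ReducesTo y d) (hd : d ≠ 0) : ReducesTo (x / y) (c / d) := by
  simpa [div_eq_mul_inv] using h.mul (h'.inv hd)

end ReducesTo

end Reduction

/-! ### Specialisation of the curve and of the multiples of `P` at `t = 0`. -/

section PointsOverRatFunc

open ReducesTo

variable {k : Type*} [Field k] {α : k}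

local notation "𝐚" => (RatFunc.C α : RatFunc k)
local notation "𝐭" => (RatFunc.X : RatFunc k)

theorem reducesTo_den :
    ReducesTo ((2 * 𝐚 ^ 3 + 1) * 𝐭 ^ 5 - 2 * 𝐚 ^ 2) (-2 * α ^ 2) := by
  -- The value is left open, assembled by the closure lemmas along the expression, and only then
  -- compared with the claimed one. Later specialisations follow the same pattern.
  apply congr_value
  · repeat' with_reducible first
      | assumption | exact ReducesTo.X | exact const _ | exact one | exact ofNat _
      | apply add | apply sub | apply mul | apply neg | apply pow
  · ring

theorem reducesTo_pX : ReducesTo (pX 𝐚 𝐭) 0 := by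
  rw [pX]
  apply congr_value
  · repeat' with_reducible first
      | assumption | exact ReducesTo.X | exact const _ | exact one | exact ofNat _
      | apply add | apply sub | apply mul | apply neg | apply pow
  · ring

variable [CharZero k]

theorem den_ne_zero (hα : α ≠ 0) : (2 * 𝐚 ^ 3 + 1) * 𝐭 ^ 5 - 2 * 𝐚 ^ 2 ≠ 0 :=
  reducesTo_den.ne_zero (by simpa using hα)

theorem reducesTo_twoPX (hα : α ≠ 0) : ReducesTo (twoPX 𝐚 𝐭) 1 := by
  rw [twoPX]
  apply congr_value
  · apply div (h' := reducesTo_den.pow 2) (hd := by simpa using hα)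
    repeat' with_reducible first
        | assumption | exact ReducesTo.X | exact const _ | exact one | exact ofNat _
        | apply add | apply sub | apply mul | apply neg | apply pow
  · field_simp
    ring

theorem reducesTo_twoPY (hα : α ≠ 0) : ReducesTo (twoPY 𝐚 𝐭) 1 := by
  have hX := reducesTo_twoPX hα
  have hP := reducesTo_pX (α := α)
  rw [twoPY]
  apply congr_value
  · apply div (h' := reducesTo_den) (hd := by simpa using hα)
    repeat' with_reducible first
        | assumption | exact ReducesTo.X | exact const _ | exact one | exact ofNat _
        | apply add | apply sub | apply mul | apply neg | apply pow
  · field_simp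
    ring

/-- At `t = 0` this is the tangent construction on `Y² = X³`: the slope at `(u², u³)` is `3u/2`, and
`(3u/2)² - 2u² = (u/2)²`. -/
theorem two_nsmul_reducesTo {X Y : RatFunc k} {u : k} (hu : u ≠ 0)
    (h : (curve 𝐚 𝐭).Nonsingular X Y) (hX : ReducesTo X (u ^ 2)) (hY : ReducesTo Y (u ^ 3)) :
    ∃ (X' Y' : RatFunc k) (h' : (curve 𝐚 𝐭).Nonsingular X' Y'),
      2 • WeierstrassCurve.Affine.Point.some X Y h =
        WeierstrassCurve.Affine.Point.some X' Y' h' ∧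
      ReducesTo X' ((u / 2) ^ 2) ∧ ReducesTo Y' ((u / 2) ^ 3) := by
  have hden : ReducesTo (2 * Y - 4 * 𝐭 ^ 5 * 𝐚 * X - 8 * 𝐭 ^ 15) (2 * u ^ 3) := by
    apply congr_value
    · repeat' with_reducible first
        | assumption | exact ReducesTo.X | exact const _ | exact one | exact ofNat _
        | apply add | apply sub | apply mul | apply neg | apply pow
    · ring
  have hu3 : 2 * u ^ 3 ≠ 0 := by simpa using hu
  obtain ⟨l, hl⟩ : ∃ l, l = (3 * X ^ 2 + 2 * (4 * 𝐭 ^ 5 * 𝐚 - 4 * 𝐭 ^ 10 * 𝐚 ^ 2) * X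
    - 16 * 𝐭 ^ 15 + 4 * 𝐭 ^ 5 * 𝐚 * Y) / (2 * Y - 4 * 𝐭 ^ 5 * 𝐚 * X - 8 * 𝐭 ^ 15) := ⟨_, rfl⟩
  have hl' : ReducesTo l (3 / 2 * u) := by
    rw [hl]
    apply congr_value
    · apply div (h' := hden) (hd := hu3)
      repeat' with_reducible first
          | assumption | exact ReducesTo.X | exact const _ | exact one | exact ofNat _
          | apply add | apply sub | apply mul | apply neg | apply pow
    · field_simp
      ring
  obtain ⟨X', hX'⟩ : ∃ X', X' = l ^ 2 - 4 * 𝐭 ^ 5 * 𝐚 * l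
    - (4 * 𝐭 ^ 5 * 𝐚 - 4 * 𝐭 ^ 10 * 𝐚 ^ 2) - 2 * X := ⟨_, rfl⟩
  have hX'r : ReducesTo X' ((u / 2) ^ 2) := by
    rw [hX']
    apply congr_value
    · repeat' with_reducible first
        | assumption | exact ReducesTo.X | exact const _ | exact one | exact ofNat _
        | apply add | apply sub | apply mul | apply neg | apply pow
    · ring
  obtain ⟨Y', hY'⟩ : ∃ Y', Y' = -(l * (X' - X) + Y) + 4 * 𝐭 ^ 5 * 𝐚 * X' + 8 * 𝐭 ^ 15 := ⟨_, rfl⟩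
  have hY'r : ReducesTo Y' ((u / 2) ^ 3) := by
    rw [hY']
    apply congr_value
    · repeat' with_reducible first
        | assumption | exact ReducesTo.X | exact const _ | exact one | exact ofNat _
        | apply add | apply sub | apply mul | apply neg | apply pow
    · ring
  obtain ⟨h', heq⟩ := two_nsmul_some h (hden.ne_zero hu3) hl hX' hY'
  exact ⟨X', Y', h', heq, hX'r, hY'r⟩

/-- The exponent starts at `n + 1` because `P` itself specialises to the cusp, where the doubling
argument does not apply. -/
theorem two_pow_nsmul_P (hα : α ≠ 0) (hP : (curve 𝐚 𝐭).Nonsingular (pX 𝐚 𝐭) (pY 𝐚 𝐭)) (n : ℕ) :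
    ∃ (X Y : RatFunc k) (h : (curve 𝐚 𝐭).Nonsingular X Y),
      2 ^ (n + 1) • WeierstrassCurve.Affine.Point.some _ _ hP =
        WeierstrassCurve.Affine.Point.some X Y h ∧
      ReducesTo X ((1 / 2 ^ n) ^ 2) ∧ ReducesTo Y ((1 / 2 ^ n) ^ 3) := by
  induction n with
  | zero =>
    obtain ⟨h, heq⟩ := two_nsmul_P two_ne_zero RatFunc.X_ne_zero (den_ne_zero hα) hP
    exact ⟨_, _, h, by simpa using heq, by simpa using reducesTo_twoPX hα,
      by simpa using reducesTo_twoPY hα⟩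
  | succ n ih =>
    obtain ⟨X, Y, h, heq, hX, hY⟩ := ih
    obtain ⟨X', Y', h', heq', hX', hY'⟩ := two_nsmul_reducesTo (by simp) h hX hY
    rw [div_div, ← pow_succ] at hX' hY'
    exact ⟨X', Y', h', by rw [pow_succ, mul_nsmul, heq, heq'], hX', hY'⟩

theorem not_isOfFinAddOrder_P (hα : α ≠ 0)
    (hP : (curve 𝐚 𝐭).Nonsingular (pX 𝐚 𝐭) (pY 𝐚 𝐭)) :
    ¬ IsOfFinAddOrder (WeierstrassCurve.Affine.Point.some _ _ hP) := by
  intro hfin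
  rw [← finite_multiples, ← Set.not_infinite] at hfin
  refine hfin (Set.infinite_of_injective_forall_mem
    (f := fun n : ℕ ↦ 2 ^ (n + 1) • WeierstrassCurve.Affine.Point.some _ _ hP) ?_
    fun n ↦ ⟨2 ^ (n + 1), rfl⟩)
  intro m n hmn
  obtain ⟨X, Y, h, heq, hX, -⟩ := two_pow_nsmul_P hα hP m
  obtain ⟨X', Y', h', heq', hX', -⟩ := two_pow_nsmul_P hα hP n
  simp only [heq, heq', WeierstrassCurve.Affine.Point.some.injEq] at hmn
  have := hX.unique (hmn.1 ▸ hX')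
  simp only [one_div, inv_pow, inv_inj, ← pow_mul] at this
  have := Nat.pow_right_injective le_rfl (by exact_mod_cast this : 2 ^ (m * 2) = 2 ^ (n * 2))
  omega

theorem family_infinite (hα : α ≠ 0) (hP : (curve 𝐚 𝐭).Nonsingular (pX 𝐚 𝐭) (pY 𝐚 𝐭)) :
    (family 𝐚 𝐭 (WeierstrassCurve.Affine.Point.some _ _ hP)).Infinite := by
  have ht : 𝐭 ≠ 0 := RatFunc.X_ne_zero
  have key (n : ℕ) : ∃ b : RatFunc k, ReducesTo b (2 ^ (n + 1)) ∧
      ∃ C : RatFunc k, ansatz 𝐚 𝐭 (𝐭 ^ 5 * b) C ∈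
        family 𝐚 𝐭 (WeierstrassCurve.Affine.Point.some _ _ hP) := by
    obtain ⟨X, Y, h, heq, hX, hY⟩ := two_pow_nsmul_P hα hP n
    have hu : (1 / 2 ^ n : k) ^ 3 ≠ 0 := by simp
    have hY0 : Y ≠ 0 := hY.ne_zero hu
    -- This quotient is `A / t^5`; with `u = 1 / 2^n` its value is `2u² / u³ = 2 / u`.
    have hb : ReducesTo (2 * (X - pX 𝐚 𝐭) / Y) (2 ^ (n + 1)) := by
      refine (((ofNat 2).mul (hX.sub reducesTo_pX)).div hY hu).congr_value ?_
      field_simp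
      ring
    have hA : coordA 𝐚 𝐭 X Y = 𝐭 ^ 5 * (2 * (X - pX 𝐚 𝐭) / Y) := by
      rw [coordA, pX]
      ring
    have hA0 : coordA 𝐚 𝐭 X Y ≠ 0 := by
      rw [hA]
      exact mul_ne_zero (pow_ne_zero 5 ht) (hb.ne_zero (by simp))
    have hAt : coordA 𝐚 𝐭 X Y ≠ 𝐭 ^ 5 := by
      rw [hA]
      intro h1
      rw [mul_eq_left₀ (pow_ne_zero 5 ht)] at h1
      rw [h1] at hb
      have h1 := hb.unique one
      have := Nat.one_lt_two_pow (Nat.succ_ne_zero n)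
      exact this.ne' (by exact_mod_cast h1)
    refine ⟨_, hb, rootC 𝐭 (coordA 𝐚 𝐭 X Y) (coordV 𝐚 𝐭 X Y), 2 ^ (n + 1), by positivity, X, Y, h,
      heq, hY0, _, _, rfl, rfl, hA0, hAt, ?_, by rw [hA]⟩
    -- With `C = 0` the quadratic collapses to `t^5 (a + A²) = 0`, while `a + A²` has the nonzero
    -- value `α` at `t = 0`.
    intro hC
    have hq := quadratic_rootC two_ne_zero ht h.1 hY0 hA0 hAt
    rw [hC, Quadratic, hA] at hq
    have hr : ReducesTo (𝐚 + (𝐭 ^ 5 * (2 * (X - pX 𝐚 𝐭) / Y)) ^ 2) α :=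
      ((const α).add (((ReducesTo.X.pow 5).mul hb).pow 2)).congr_value (by ring)
    refine mul_ne_zero (pow_ne_zero 5 ht) (hr.ne_zero hα) ?_
    linear_combination hq
  choose b hb C hC using key
  refine Set.infinite_of_injective_forall_mem
    (f := fun n : ℕ ↦ ansatz 𝐚 𝐭 (𝐭 ^ 5 * b n) (C n)) ?_ hC
  intro m n hmn
  -- The entry `x = t / A` alone separates the solutions, since it determines `b`.
  have h1 : 𝐭 / (𝐭 ^ 5 * b m) = 𝐭 / (𝐭 ^ 5 * b n) := congrArg (fun p ↦ p.2.1) hmn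
  simp only [div_eq_mul_inv] at h1
  rw [mul_right_inj' ht, inv_inj, mul_right_inj' (pow_ne_zero 5 ht)] at h1
  have h2 := (hb m).unique (h1 ▸ hb n)
  have := Nat.pow_right_injective le_rfl (by exact_mod_cast h2 : 2 ^ (m + 1) = 2 ^ (n + 1))
  omega

/-- The discriminant is nonzero because its lowest-order term in `t` is `262144 α^4 t^35`. -/
theorem isElliptic_curve (hα : α ≠ 0) : (curve 𝐚 𝐭).IsElliptic := by
  have hΔ : (curve 𝐚 𝐭).Δ = 𝐭 ^ 35 * (262144 * 𝐚 ^ 4 + 𝐭 ^ 5 * (-524288 * 𝐚 ^ 2 - 262144 * 𝐚 ^ 5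
      + 𝐭 ^ 5 * (262144 + 983040 * 𝐚 ^ 3) + 𝐭 ^ 10 * (-196608 * 𝐚 - 524288 * 𝐚 ^ 4)
      + 𝐭 ^ 15 * (196608 * 𝐚 ^ 2) + 𝐭 ^ 20 * (-110592 - 262144 * 𝐚 ^ 3))) := by
    simp only [WeierstrassCurve.Δ, WeierstrassCurve.b₂, WeierstrassCurve.b₄, WeierstrassCurve.b₆,
      WeierstrassCurve.b₈, curve]
    ring
  refine ⟨?_⟩
  rw [hΔ, isUnit_iff_ne_zero]
  refine mul_ne_zero (pow_ne_zero 35 RatFunc.X_ne_zero) (ne_zero (c := 262144 * α ^ 4) ?_ ?_)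
  · apply congr_value
    · repeat' with_reducible first
        | assumption | exact ReducesTo.X | exact const _ | exact one | exact ofNat _
        | apply add | apply sub | apply mul | apply neg | apply pow
    · ring
  · simpa using hα

theorem isBirational {k : Type} [Field k] [CharZero k] {α : k} (hα : α ≠ 0) :
    IsBirational (RatFunc.C α) (RatFunc.X : RatFunc k) := by
  intro L _ _
  -- Injectivity carries the nonvanishing of `2`, `t` and the denominator of `2P` to the extension
  -- field, and nothing else is needed there.
  have hinj := FaithfulSMul.algebraMap_injective (RatFunc k) L
  have h2 := (map_ne_zero_iff _ hinj).2 (two_ne_zero (α := RatFunc k))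
  have hD := (map_ne_zero_iff _ hinj).2 (den_ne_zero hα)
  simp only [map_sub, map_mul, map_add, map_pow, map_one, map_ofNat] at h2 hD
  exact inverseOffFinite h2 ((map_ne_zero_iff _ hinj).2 RatFunc.X_ne_zero) hD

/-- The denominator of `twoPA` and the numerator and the denominator of `twoPC`
are nonzero. -/
theorem twoP_denominators_ne_zero (hα : α ≠ 0) :
    𝐭 ^ 10 * 𝐚 ^ 4 - 2 * 𝐭 ^ 5 * 𝐚 ^ 3 - 𝐭 ^ 5 + 𝐚 ^ 2 ≠ 0 ∧
    𝐭 ^ 10 + 𝐚 - 2 * 𝐭 ^ 5 * 𝐚 ^ 2 + 𝐭 ^ 10 * 𝐚 ^ 3 ≠ 0 ∧ 𝐭 ^ 10 * 𝐚 ^ 2 - 1 ≠ 0 := by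
  refine ⟨ne_zero (c := α ^ 2) ?_ (pow_ne_zero 2 hα), ne_zero (c := α) ?_ hα,
    ne_zero (c := -1) ?_ (by simp)⟩
  all_goals
    apply congr_value
    · repeat' with_reducible first
        | assumption | exact ReducesTo.X | exact const _ | exact one | exact ofNat _
        | apply add | apply sub | apply mul | apply neg | apply pow
    · ring

/-- At `t = 0` the quotient `A / t^5` has the value `2`, not `1`. -/
theorem twoPA_ne (hα : α ≠ 0) : twoPA 𝐚 𝐭 ≠ 𝐭 ^ 5 := by
  have hN := (twoP_denominators_ne_zero hα).1
  intro h
  rw [twoPA, div_eq_iff hN, neg_mul, ← mul_neg,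
    mul_right_inj' (pow_ne_zero 5 RatFunc.X_ne_zero)] at h
  have h1 : ReducesTo (-(-2 * 𝐚 ^ 2 + 2 * 𝐭 ^ 5 * 𝐚 ^ 3 + 𝐭 ^ 5)) (2 * α ^ 2) := by
    apply congr_value
    · repeat' with_reducible first
        | assumption | exact ReducesTo.X | exact const _ | exact one | exact ofNat _
        | apply add | apply sub | apply mul | apply neg | apply pow
    · ring
  have h2 : ReducesTo (𝐭 ^ 10 * 𝐚 ^ 4 - 2 * 𝐭 ^ 5 * 𝐚 ^ 3 - 𝐭 ^ 5 + 𝐚 ^ 2) (α ^ 2) := by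
    apply congr_value
    · repeat' with_reducible first
        | assumption | exact ReducesTo.X | exact const _ | exact one | exact ofNat _
        | apply add | apply sub | apply mul | apply neg | apply pow
    · ring
  have h3 := h1.unique (h ▸ h2)
  refine pow_ne_zero 2 hα ?_
  linear_combination h3

end PointsOverRatFunc

end WXYZ

namespace WXYZ

/-! ### The explicit solution coming from `2P`. -/

section TwoP

variable {K : Type*} [Field K] {a t : K}

/-- The factor `twoPX - pX` in `twoPY` matches the numerator of `coordA`, so `twoPX` need not be
expanded. -/
theorem coordA_twoP (hD : (2 * a ^ 3 + 1) * t ^ 5 - 2 * a ^ 2 ≠ 0)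
    (hN : t ^ 10 * a ^ 4 - 2 * t ^ 5 * a ^ 3 - t ^ 5 + a ^ 2 ≠ 0) (hY : twoPY a t ≠ 0) :
    coordA a t (twoPX a t) (twoPY a t) = twoPA a t := by
  rw [coordA, twoPA, div_eq_div_iff hY hN, twoPY, pX,
    show -2 * a ^ 2 + 2 * t ^ 5 * a ^ 3 + t ^ 5 = (2 * a ^ 3 + 1) * t ^ 5 - 2 * a ^ 2 by ring]
  generalize (2 * a ^ 3 + 1) * t ^ 5 - 2 * a ^ 2 = D at *
  field_simp
  ring

theorem rootC_twoP (h2 : (2 : K) ≠ 0) (ht : t ≠ 0)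
    (hD : (2 * a ^ 3 + 1) * t ^ 5 - 2 * a ^ 2 ≠ 0)
    (hN : t ^ 10 * a ^ 4 - 2 * t ^ 5 * a ^ 3 - t ^ 5 + a ^ 2 ≠ 0)
    (hM : t ^ 10 * a ^ 2 - 1 ≠ 0)
    (hA0 : twoPA a t ≠ 0) (hAt : twoPA a t ≠ t ^ 5) {v : K}
    (hv : v = -t ^ 5 + twoPA a t * (twoPA a t * twoPX a t + 4 * t ^ 10 * a) / (2 * t ^ 5)) :
    rootC t (twoPA a t) v = twoPC a t := by
  have hd : 2 * (t ^ 5 * twoPA a t - twoPA a t ^ 2) ≠ 0 := by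
    rw [show t ^ 5 * twoPA a t - twoPA a t ^ 2 = twoPA a t * (t ^ 5 - twoPA a t) by ring]
    exact mul_ne_zero h2 (mul_ne_zero hA0 (sub_ne_zero.2 hAt.symm))
  rw [rootC, twoPC, div_eq_div_iff hd hM, hv, twoPA, twoPX]
  set D := (2 * a ^ 3 + 1) * t ^ 5 - 2 * a ^ 2 with hDdef
  rw [show -2 * a ^ 2 + 2 * t ^ 5 * a ^ 3 + t ^ 5 = D by rw [hDdef]; ring]
  set N := t ^ 10 * a ^ 4 - 2 * t ^ 5 * a ^ 3 - t ^ 5 + a ^ 2 with hNdef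
  field_simp
  rw [hDdef, hNdef]
  ring

theorem ansatz_twoP (hD : (2 * a ^ 3 + 1) * t ^ 5 - 2 * a ^ 2 ≠ 0) (ht : t ≠ 0)
    (hN : t ^ 10 * a ^ 4 - 2 * t ^ 5 * a ^ 3 - t ^ 5 + a ^ 2 ≠ 0)
    (hR : t ^ 10 + a - 2 * t ^ 5 * a ^ 2 + t ^ 10 * a ^ 3 ≠ 0)
    (hM : t ^ 10 * a ^ 2 - 1 ≠ 0) :
    ansatz a t (twoPA a t) (twoPC a t) = twoPSolution a t := by
  have hM' : t ^ 10 * a ^ 2 - 1 = (t ^ 5 * a + 1) * (t ^ 5 * a - 1) := by ring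
  rw [hM'] at hM
  obtain ⟨hM₁, hM₂⟩ := mul_ne_zero_iff.1 hM
  rw [ansatz, twoPA, twoPC, twoPSolution, hM']
  rw [show (2 * a ^ 3 + 1) * t ^ 5 - 2 * a ^ 2 = -2 * a ^ 2 + 2 * t ^ 5 * a ^ 3 + t ^ 5 by ring]
    at hD
  generalize -2 * a ^ 2 + 2 * t ^ 5 * a ^ 3 + t ^ 5 = D at *
  generalize t ^ 10 * a ^ 4 - 2 * t ^ 5 * a ^ 3 - t ^ 5 + a ^ 2 = N at *
  generalize t ^ 10 + a - 2 * t ^ 5 * a ^ 2 + t ^ 10 * a ^ 3 = R at *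
  generalize t ^ 5 * a + 1 = M₁ at *
  generalize t ^ 5 * a - 1 = M₂ at *
  simp only [Prod.mk.injEq]
  refine ⟨?_, ?_, ?_, ?_⟩ <;> field_simp

end TwoP

end WXYZ

theorem mainTheorem3 :
    -- over `ℚ(a, t)`: reduction of the ansatz to the quadratic equation and to the quartic
    (∀ A C : WXYZ.Qat, A ≠ 0 → C ≠ 0 →
      (WXYZ.IsSolution WXYZ.aGen (WXYZ.ansatz WXYZ.aGen WXYZ.tGen A C) ↔
        WXYZ.Quadratic WXYZ.aGen WXYZ.tGen A C)) ∧
    (∀ A C : WXYZ.Qat, A ≠ 0 → A ≠ WXYZ.tGen ^ 5 →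
      (WXYZ.Quadratic WXYZ.aGen WXYZ.tGen A C ↔
        ∃ v : WXYZ.Qat, (A, v) ∈ WXYZ.quarticPoints WXYZ.aGen WXYZ.tGen ∧
          C = WXYZ.rootC WXYZ.tGen A v)) ∧
    -- the quartic is birational to the elliptic curve
    (WXYZ.curve WXYZ.aGen WXYZ.tGen).IsElliptic ∧
    WXYZ.IsBirational WXYZ.aGen WXYZ.tGen ∧
    -- `P` is a point of infinite order, `2P` gives the explicit solution,
    -- and the multiples of `P` give infinitely many solutions
    (∃ hP : (WXYZ.curve WXYZ.aGen WXYZ.tGen).Nonsingular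
        (WXYZ.pX WXYZ.aGen WXYZ.tGen) (WXYZ.pY WXYZ.aGen WXYZ.tGen),
      ¬ IsOfFinAddOrder (WeierstrassCurve.Affine.Point.some _ _ hP) ∧
      (∃ (Y : WXYZ.Qat) (h : (WXYZ.curve WXYZ.aGen WXYZ.tGen).Nonsingular
          (WXYZ.twoPX WXYZ.aGen WXYZ.tGen) Y),
        2 • WeierstrassCurve.Affine.Point.some _ _ hP =
          WeierstrassCurve.Affine.Point.some _ _ h ∧
        Y ≠ 0 ∧
        WXYZ.coordA WXYZ.aGen WXYZ.tGen (WXYZ.twoPX WXYZ.aGen WXYZ.tGen) Y =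
          WXYZ.twoPA WXYZ.aGen WXYZ.tGen ∧
        WXYZ.rootC WXYZ.tGen (WXYZ.twoPA WXYZ.aGen WXYZ.tGen)
          (WXYZ.coordV WXYZ.aGen WXYZ.tGen (WXYZ.twoPX WXYZ.aGen WXYZ.tGen) Y) =
          WXYZ.twoPC WXYZ.aGen WXYZ.tGen) ∧
      WXYZ.ansatz WXYZ.aGen WXYZ.tGen (WXYZ.twoPA WXYZ.aGen WXYZ.tGen)
          (WXYZ.twoPC WXYZ.aGen WXYZ.tGen) = WXYZ.twoPSolution WXYZ.aGen WXYZ.tGen ∧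
      WXYZ.twoPSolution WXYZ.aGen WXYZ.tGen ∈ WXYZ.family WXYZ.aGen WXYZ.tGen
        (WeierstrassCurve.Affine.Point.some _ _ hP) ∧
      (∀ p ∈ WXYZ.family WXYZ.aGen WXYZ.tGen (WeierstrassCurve.Affine.Point.some _ _ hP),
        WXYZ.IsSolution WXYZ.aGen p) ∧
      (WXYZ.family WXYZ.aGen WXYZ.tGen
        (WeierstrassCurve.Affine.Point.some _ _ hP)).Infinite) ∧
    -- for every fixed nonzero rational number `a`: infinitely many solutions over `ℚ(t)`
    (∀ r : ℚ, r ≠ 0 →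
      ∃ hP : (WXYZ.curve (RatFunc.C r) (RatFunc.X : RatFunc ℚ)).Nonsingular
          (WXYZ.pX (RatFunc.C r) RatFunc.X) (WXYZ.pY (RatFunc.C r) RatFunc.X),
        ¬ IsOfFinAddOrder (WeierstrassCurve.Affine.Point.some _ _ hP) ∧
        (∀ p ∈ WXYZ.family (RatFunc.C r) (RatFunc.X : RatFunc ℚ)
            (WeierstrassCurve.Affine.Point.some _ _ hP),
          WXYZ.IsSolution (RatFunc.C r) p) ∧
        (WXYZ.family (RatFunc.C r) (RatFunc.X : RatFunc ℚ)
          (WeierstrassCurve.Affine.Point.some _ _ hP)).Infinite) := by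
  have h2 : (2 : WXYZ.Qat) ≠ 0 := two_ne_zero
  -- This serves twice: as `α ≠ 0` in the coefficient field `ℚ(a)`, and as `t ≠ 0` in `ℚ(t)` for a
  -- fixed rational `a`.
  have hX : (RatFunc.X : RatFunc ℚ) ≠ 0 := RatFunc.X_ne_zero
  have ht : WXYZ.tGen ≠ 0 := RatFunc.X_ne_zero
  have ha : WXYZ.aGen ≠ 0 := by simpa [WXYZ.aGen] using hX
  have hD := WXYZ.den_ne_zero hX
  obtain ⟨hN, hR, hM⟩ := WXYZ.twoP_denominators_ne_zero hX
  refine ⟨fun A C ↦ WXYZ.isSolution_ansatz_iff ha, fun A C ↦ WXYZ.quadratic_iff h2,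
    WXYZ.isElliptic_curve hX, WXYZ.isBirational hX, ?_, fun r hr ↦ ?_⟩
  · have hP := WXYZ.nonsingular_P h2 ht hD
    obtain ⟨h, heq⟩ := WXYZ.two_nsmul_P h2 ht hD hP
    have hY := (WXYZ.reducesTo_twoPY hX).ne_zero one_ne_zero
    have hA := WXYZ.coordA_twoP hD hN hY
    have hA0 : WXYZ.twoPA WXYZ.aGen WXYZ.tGen ≠ 0 := by
      refine div_ne_zero (mul_ne_zero (neg_ne_zero.2 (pow_ne_zero 5 ht)) ?_) hN
      convert hD using 1
      simp only [WXYZ.aGen, WXYZ.tGen]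
      ring
    have hAt : WXYZ.twoPA WXYZ.aGen WXYZ.tGen ≠ WXYZ.tGen ^ 5 := WXYZ.twoPA_ne hX
    have hC := WXYZ.rootC_twoP h2 ht hD hN hM hA0 hAt
      (v := WXYZ.coordV WXYZ.aGen WXYZ.tGen (WXYZ.twoPX WXYZ.aGen WXYZ.tGen)
        (WXYZ.twoPY WXYZ.aGen WXYZ.tGen)) (by rw [WXYZ.coordV]; erw [hA]; rfl)
    have hans := WXYZ.ansatz_twoP hD ht hN hR hM
    exact ⟨hP, WXYZ.not_isOfFinAddOrder_P hX hP, ⟨_, h, heq, hY, hA, hC⟩, hans,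
      ⟨2, two_pos, _, _, h, heq, hY, _, _, hA.symm, hC.symm, hA0, hAt, div_ne_zero hR hM,
        hans.symm⟩,
      fun p ↦ WXYZ.isSolution_of_mem_family h2 ha ht, WXYZ.family_infinite hX hP⟩
  · have hP := WXYZ.nonsingular_P two_ne_zero hX (WXYZ.den_ne_zero hr)
    exact ⟨hP, WXYZ.not_isOfFinAddOrder_P hr hP,
      fun p ↦ WXYZ.isSolution_of_mem_family two_ne_zero (by simpa using hr) hX,
      WXYZ.family_infinite hr hP⟩
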